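/- Let $n\ge 0$ and let $\mathcal X_1,\dots,\mathcal X_n$ be nonempty Polish spaces with their Borel $\sigma$-fields. For each $i$ let $c_i:\mathcal X_i\times\mathcal X_i\to[0,\infty)$ be lower semicontinuous, and on $\mathcal X^{(n)}=\prod_{i=1}^n\mathcal X_i$ put $\oplus_i c_i(x,y)=\sum_{i=1}^n c_i(x_i,y_i)$. For a cost $c:E\times E\to[0,\infty)$ and probability measures $\nu,\mu$ on $E$, let $$\mathcal T_c(\nu,\mu)=\inf\Big\{\int_{E\times E}c\,d\pi\ :\ \pi \text{ a probability measure on } E\times E \text{ with first marginal } \nu \text{ and second marginal } \mu\Big\}\in[0,\infty].$$ Let $\mu=\bigotimes_{i=1}^n\mu_i$ be a product of probability measures $\mu_i$ on $\mathcal X_i$. Let $\nu$ be any probability measure on $\mathcal X^{(n)}$. For $x\in\mathcal X^{(n)}$ write $\widetilde x_i=(x_j)_{j\ne i}$, and let $\nu_i^{\widetilde x_i}$ be the regular conditional distribution, under $\nu$, of the $i$-th coordinate given that the other coordinates equal $\widetilde x_i$. Then for each $i$ the function $x\mapsto\mathcal T_{c_i}(\nu_i^{\widetilde x_i},\mu_i)\in[0,\infty]$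 is $\nu$-measurable, and $$\mathcal T_{\oplus_i c_i}(\nu,\mu)\ \le\ \int_{\mathcal X^{(n)}}\sum_{i=1}^n\mathcal T_{c_i}(\nu_i^{\widetilde x_i},\mu_i)\,d\nu(x).$$ -/

import Mathlib

open MeasureTheory ProbabilityTheory
open scoped NNReal ENNReal

noncomputable section

/-- `π` is a coupling of `ν` and `μ`: a probability measure on `E × E` whose first marginal is `ν`
and whose second marginal is `μ`. -/
def IsCoupling {E : Type*} [MeasurableSpace E] (π : Measure (E × E)) (ν μ : Measure E) : Prop :=
  IsProbabilityMeasure π ∧ π.map Prod.fst = ν ∧ π.map Prod.snd = μ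

/-- The optimal transport cost `T_c(ν, μ) ∈ [0, ∞]`: the infimum of `∫ c dπ` over all couplings `π`
of `ν` and `μ`. -/
def transportCost {E : Type*} [MeasurableSpace E] (c : E → E → ℝ≥0) (ν μ : Measure E) : ℝ≥0∞ :=
  ⨅ (π : Measure (E × E)) (_ : IsCoupling π ν μ), ∫⁻ z, (c z.1 z.2 : ℝ≥0∞) ∂π

/-- The cost `⊕ c_i` on the product space: `(x, y) ↦ ∑ i, c_i (x_i, y_i)`. -/
def sumCost {n : ℕ} {X : Fin n → Type*} (c : ∀ i, X i → X i → ℝ≥0) (x y : ∀ i, X i) : ℝ≥0 :=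
  ∑ i, c i (x i) (y i)

/-- The configuration `x` without its value at the index `i`. -/
def eraseCoord {n : ℕ} {X : Fin n → Type*} (i : Fin n) (x : ∀ j, X j) :
    ∀ j : {j : Fin n // j ≠ i}, X j :=
  fun j => x j

/-- The regular conditional distribution, under `ν`, of the `i`-th coordinate given all the other
coordinates, as a kernel in the values of the other coordinates. -/
def condCoord {n : ℕ} {X : Fin n → Type*} [∀ j, MeasurableSpace (X j)]
    (ν : Measure (∀ j, X j)) [IsFiniteMeasure ν] (i : Fin n)
    [StandardBorelSpace (X i)] [Nonempty (X i)] :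
    Kernel (∀ j : {j : Fin n // j ≠ i}, X j) (X i) :=
  condDistrib (fun x : ∀ j, X j => x i) (eraseCoord i) ν

end

/-! Induction on `n`, splitting off the coordinate `0`. A nearly optimal coupling of the law of the
tail with the product of the remaining `μ i` is glued to nearly optimal couplings of the conditional
laws of `x 0` given the tail with `μ 0`. The second marginal of these couplings is `μ 0` whatever
the tail, so the glued plan has the product measure as second marginal, and its cost is the sum of
both costs (`transportCost_prod_le`).

The induction hypothesis for the tail conditions `x i` on fewer coordinates than the theorem does.
Averaging couplings over the forgotten coordinate shows that this only lowers the mean cost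
(`condTransportCost_map_le`).

Gluing needs couplings that depend measurably on the conditioning. With probability measures
parametrized by a Polish space, the sublevel sets of the cost are projections of Borel sets.
`exists_measurable_ae_selection` makes them null-measurable and supplies the couplings. -/

/-! ### Measurable selection from Borel sets. -/

/-- A continuous image of a compact metric space admits a measurable section. -/
lemma exists_measurable_section_of_compact {W Y : Type*} [MetricSpace W] [CompactSpace W]
    [Nonempty W] [MeasurableSpace W] [BorelSpace W] [TopologicalSpace Y] [T2Space Y]
    [MeasurableSpace Y] [BorelSpace Y] {p : W → Y} (hp : Continuous p) :
    ∃ s : Y → W, Measurable s ∧ ∀ y ∈ Set.range p, p (s y) = y := by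
  obtain ⟨f, hf, hfs⟩ := exists_nat_bool_continuous_surjective_of_compact W
  set q : cantorSet → W := f ∘ cantorSetHomeomorphNatToBool with hq
  have hqc : Continuous q := hf.comp cantorSetHomeomorphNatToBool.continuous
  have hqs : Function.Surjective q := hfs.comp cantorSetHomeomorphNatToBool.surjective
  have hC : IsCompact cantorSet := isCompact_cantorSet
  have : CompactSpace cantorSet := isCompact_iff_compactSpace.mp hC
  have hemb : MeasurableEmbedding (Subtype.val : cantorSet → ℝ) :=
    MeasurableEmbedding.subtype_coe hC.measurableSet
  let w₀ : W := Classical.arbitrary W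
  -- The fibres become compact subsets of the line, and the section picks the least point of each.
  let F : Y → Set ℝ := fun y => Subtype.val '' ((p ∘ q) ⁻¹' {y})
  have hFc : ∀ y, IsCompact (F y) := fun y =>
    ((isClosed_singleton.preimage (hp.comp hqc)).isCompact).image continuous_subtype_val
  have hFne : ∀ y ∈ Set.range p, (F y).Nonempty := by
    rintro _ ⟨w, rfl⟩
    obtain ⟨t, rfl⟩ := hqs w
    exact ⟨t, t, rfl, rfl⟩
  have hFempty : ∀ y ∉ Set.range p, F y = ∅ := by
    intro y hy
    rw [Set.eq_empty_iff_forall_notMem]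
    rintro _ ⟨t, ht, rfl⟩
    exact hy ⟨q t, ht⟩
  have hrange : MeasurableSet (Set.range p) := (isCompact_range hp).isClosed.measurableSet
  have ht : Measurable fun y => sInf (F y) := by
    refine measurable_of_Iic fun a => ?_
    have himg : MeasurableSet ((p ∘ q) '' {t | (t : ℝ) ≤ a}) :=
      (((isClosed_Iic.preimage continuous_subtype_val).isCompact).image
        (hp.comp hqc)).isClosed.measurableSet
    -- Off the range of `p` the fibre is empty and its `sInf` is `0`, whence the second piece.
    have : (fun y => sInf (F y)) ⁻¹' Set.Iic a
        = (p ∘ q) '' {t | (t : ℝ) ≤ a} ∪ ((Set.range p)ᶜ ∩ {_y | (0 : ℝ) ≤ a}) := by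
      ext y
      by_cases hy : y ∈ Set.range p
      · simp only [Set.mem_preimage, Set.mem_Iic, Set.mem_union, Set.mem_inter_iff,
          Set.mem_compl_iff, hy, not_true_eq_false, false_and, or_false]
        constructor
        · intro h
          obtain ⟨t, ht1, ht2⟩ := (hFc y).sInf_mem (hFne y hy)
          exact ⟨t, by simpa [ht2] using h, ht1⟩
        · rintro ⟨t, ht1, ht2⟩
          exact (csInf_le (hFc y).bddBelow ⟨t, ht2, rfl⟩).trans ht1
      · have : y ∉ (p ∘ q) '' {t | (t : ℝ) ≤ a} := by
          rintro ⟨t, -, rfl⟩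
          exact hy ⟨_, rfl⟩
        simp only [Set.mem_preimage, Set.mem_Iic, Set.mem_union, this, false_or, hFempty y hy,
          Real.sInf_empty, Set.mem_inter_iff, Set.mem_compl_iff, hy, not_false_eq_true, true_and,
          Set.mem_ofPred_eq]
    rw [this]
    exact himg.union (hrange.compl.inter (MeasurableSet.const _))
  refine ⟨fun y => Function.extend Subtype.val q (fun _ => w₀) (sInf (F y)),
    (hemb.measurable_extend hqc.measurable measurable_const).comp ht, fun y hy => ?_⟩
  obtain ⟨t, ht1, ht2⟩ := (hFc y).sInf_mem (hFne y hy)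
  simp only [← ht2, Subtype.val_injective.extend_apply]
  exact ht1

lemma isCompact_baire_box (τ : ℕ → ℕ) : IsCompact {σ : ℕ → ℕ | ∀ i, σ i ≤ τ i} := by
  have : {σ : ℕ → ℕ | ∀ i, σ i ≤ τ i} = Set.pi Set.univ fun i => Set.Iic (τ i) := by
    ext; simp [Pi.le_def]
  rw [this]
  exact isCompact_univ_pi fun i => (Set.finite_Iic (τ i)).isCompact

/-- An open set containing the compact box `{σ | σ ≤ τ}` of the Baire space contains all the
sequences which are bounded by `τ` up to some finite rank. -/
lemma exists_box_subset_of_isOpen {τ : ℕ → ℕ} {U : Set (ℕ → ℕ)} (hU : IsOpen U)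
    (h : {σ : ℕ → ℕ | ∀ i, σ i ≤ τ i} ⊆ U) :
    ∃ n : ℕ, {σ : ℕ → ℕ | ∀ i < n, σ i ≤ τ i} ⊆ U := by
  by_contra! hcon
  simp only [Set.not_subset] at hcon
  choose σ hσ hσU using hcon
  have hK := isCompact_baire_box τ
  -- The truncations lie in the compact box, and each coordinate of `σ n` is eventually equal to its
  -- truncation, so both have the same limit along `φ`.
  obtain ⟨a, haK, φ, hφ, hlim⟩ := hK.tendsto_subseq (x := fun n i => min (σ n i) (τ i))
    (fun n i => min_le_right _ _)
  have hlim' : Filter.Tendsto (σ ∘ φ) Filter.atTop (nhds a) := by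
    rw [tendsto_pi_nhds] at hlim ⊢
    intro i
    refine (hlim i).congr' ?_
    filter_upwards [hφ.tendsto_atTop.eventually_gt_atTop i] with n hn
    exact min_eq_left (hσ _ i hn)
  obtain ⟨n, hn⟩ := (hlim'.eventually (hU.mem_nhds (h haK))).exists
  exact hσU _ hn

/-- Continuous images of the Baire space are exhausted, up to small measure, by images of compact
sets. -/
lemma exists_isCompact_measure_range_le {Y : Type*} [TopologicalSpace Y] [PolishSpace Y]
    [MeasurableSpace Y] [BorelSpace Y] (m : Measure Y) [IsFiniteMeasure m] {p : (ℕ → ℕ) → Y}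
    (hp : Continuous p) {ε : ℝ≥0∞} (hε : ε ≠ 0) :
    ∃ K : Set (ℕ → ℕ), IsCompact K ∧ m (Set.range p) ≤ m (p '' K) + ε := by
  have hε2 : ε / 2 ≠ 0 := (ENNReal.half_pos hε).ne'
  obtain ⟨δ, hδ, hδs⟩ := ENNReal.exists_pos_sum_of_countable' hε2 ℕ
  -- Continuity from below along increasing unions holds for arbitrary sets, so the images need not
  -- be measurable.
  have step : ∀ (S : Set (ℕ → ℕ)) (i : ℕ), ∃ k : ℕ,
      m (p '' S) ≤ m (p '' (S ∩ {σ | σ i ≤ k})) + δ i := by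
    intro S i
    have hmono : Monotone fun k : ℕ => p '' (S ∩ {σ | σ i ≤ k}) := fun a b hab =>
      Set.image_mono fun σ hσ => ⟨hσ.1, le_trans hσ.2 hab⟩
    have hun : p '' S = ⋃ k : ℕ, p '' (S ∩ {σ | σ i ≤ k}) := by
      rw [← Set.image_iUnion, ← Set.inter_iUnion]
      congr 1
      ext σ
      simp only [Set.mem_inter_iff, Set.mem_iUnion, Set.mem_ofPred_eq]
      exact ⟨fun h => ⟨h, _, le_rfl⟩, fun h => h.1⟩
    have hlim := tendsto_measure_iUnion_atTop (μ := m) hmono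
    rw [← hun] at hlim
    by_cases h0 : m (p '' S) = 0
    · exact ⟨0, by simp [h0]⟩
    have hlt : m (p '' S) - δ i < m (p '' S) :=
      ENNReal.sub_lt_self (measure_ne_top _ _) h0 (hδ i).ne'
    obtain ⟨k, hk⟩ := (hlim.eventually (lt_mem_nhds hlt)).exists
    exact ⟨k, tsub_le_iff_right.mp hk.le⟩
  choose f hf using step
  let S : ℕ → Set (ℕ → ℕ) := fun n => Nat.rec Set.univ (fun i T => T ∩ {σ | σ i ≤ f T i}) n
  have hS : ∀ n, S (n + 1) = S n ∩ {σ | σ n ≤ f (S n) n} := fun n => rfl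
  let τ : ℕ → ℕ := fun n => f (S n) n
  have hSbox : ∀ n, S n = {σ : ℕ → ℕ | ∀ i < n, σ i ≤ τ i} := by
    intro n
    induction n with
    | zero => ext; simp [S]
    | succ n ih =>
      rw [hS, ih]
      ext σ
      simp only [Set.mem_inter_iff, Set.mem_ofPred_eq, Nat.lt_succ_iff_lt_or_eq, or_imp,
        forall_and, forall_eq]
      rw [← ih]
  have hSm : ∀ n, m (Set.range p) ≤ m (p '' S n) + ∑ i ∈ Finset.range n, δ i := by
    intro n
    induction n with
    | zero => simp [S]
    | succ n ih =>
      rw [Finset.sum_range_succ, hS, add_comm (∑ i ∈ _, _), ← add_assoc]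
      exact ih.trans (by gcongr; exact hf _ _)
  have hK := isCompact_baire_box τ
  refine ⟨_, hK, ?_⟩
  let := TopologicalSpace.upgradeIsCompletelyMetrizable Y
  -- Images do not commute with the decreasing intersection of the `S n`; an open `V` around the
  -- compact image contains the image of some `S n` instead.
  obtain ⟨V, hKV, hVo, hV⟩ := (p '' {σ : ℕ → ℕ | ∀ i, σ i ≤ τ i}).exists_isOpen_lt_add (μ := m)
    (measure_ne_top _ _) hε2
  obtain ⟨n, hn⟩ := exists_box_subset_of_isOpen (hVo.preimage hp) (Set.image_subset_iff.mp hKV)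
  calc m (Set.range p) ≤ m (p '' S n) + ∑ i ∈ Finset.range n, δ i := hSm n
    _ ≤ m V + ε / 2 := by
        gcongr
        · rw [hSbox]; exact Set.image_subset_iff.mpr hn
        · exact (ENNReal.sum_le_tsum _).trans hδs.le
    _ ≤ m (p '' {σ : ℕ → ℕ | ∀ i, σ i ≤ τ i}) + ε / 2 + ε / 2 := by gcongr
    _ = _ := by rw [add_assoc, ENNReal.add_halves]

/-- **Measurable selection**: a measurable subset `B` of a product of standard Borel spaces has a
null-measurable projection, and almost everywhere on this projection a measurable section. -/
theorem exists_measurable_ae_selection {Y E : Type*} [MeasurableSpace Y] [StandardBorelSpace Y]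
    [MeasurableSpace E] [StandardBorelSpace E] [Nonempty E] (m : Measure Y) [IsFiniteMeasure m]
    {B : Set (Y × E)} (hB : MeasurableSet B) :
    NullMeasurableSet (Prod.fst '' B) m ∧
      ∃ s : Y → E, Measurable s ∧ ∀ᵐ y ∂m, y ∈ Prod.fst '' B → (y, s y) ∈ B := by
  let := upgradeStandardBorel Y
  let := upgradeStandardBorel E
  have hBa := hB.analyticSet
  rw [AnalyticSet] at hBa
  rcases hBa with rfl | ⟨g, hg, hgB⟩
  · exact ⟨by simp, fun _ => Classical.arbitrary E, measurable_const, by simp⟩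
  have hp : Continuous (Prod.fst ∘ g) := continuous_fst.comp hg
  have hrange : Set.range (Prod.fst ∘ g) = Prod.fst '' B := by rw [Set.range_comp, hgB]
  have hK : ∀ n : ℕ, ∃ K : Set (ℕ → ℕ), IsCompact K ∧
      m (Prod.fst '' B) ≤ m ((Prod.fst ∘ g) '' K) + (n + 1 : ℝ≥0∞)⁻¹ := by
    intro n
    rw [← hrange]
    exact exists_isCompact_measure_range_le m hp (by simp)
  choose K hKc hKm using hK
  have hKmeas : ∀ n, MeasurableSet ((Prod.fst ∘ g) '' K n) := fun n =>
    ((hKc n).image hp).isClosed.measurableSet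
  have hsub : (⋃ n, (Prod.fst ∘ g) '' K n) ⊆ Prod.fst '' B := by
    rw [← hrange]
    exact Set.iUnion_subset fun n => Set.image_subset_range _ _
  have hUmeas : MeasurableSet (⋃ n, (Prod.fst ∘ g) '' K n) := .iUnion hKmeas
  have hle : m (Prod.fst '' B) ≤ m (⋃ n, (Prod.fst ∘ g) '' K n) := by
    have hlim : Filter.Tendsto (fun n : ℕ => m (⋃ n, (Prod.fst ∘ g) '' K n) + (n + 1 : ℝ≥0∞)⁻¹)
        Filter.atTop (nhds (m (⋃ n, (Prod.fst ∘ g) '' K n) + 0)) := by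
      refine tendsto_const_nhds.add ?_
      have := (Filter.tendsto_add_atTop_iff_nat 1).mpr ENNReal.tendsto_inv_nat_nhds_zero
      simpa using this
    rw [add_zero] at hlim
    refine ge_of_tendsto' hlim fun n => (hKm n).trans ?_
    gcongr
    exact Set.subset_iUnion (fun n => (Prod.fst ∘ g) '' K n) n
  have hae : (⋃ n, (Prod.fst ∘ g) '' K n) =ᵐ[m] Prod.fst '' B :=
    ae_eq_of_subset_of_measure_ge hsub hle hUmeas.nullMeasurableSet (measure_ne_top _ _)
  have hsec : ∀ n, ∃ s : Y → E, Measurable s ∧ ∀ y ∈ (Prod.fst ∘ g) '' K n, (y, s y) ∈ B := by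
    intro n
    rcases (K n).eq_empty_or_nonempty with h0 | hne
    · exact ⟨fun _ => Classical.arbitrary E, measurable_const, by simp [h0]⟩
    let := TopologicalSpace.metrizableSpaceMetric (K n)
    have : CompactSpace (K n) := isCompact_iff_compactSpace.mp (hKc n)
    have : Nonempty (K n) := hne.to_subtype
    obtain ⟨s, hs, hsp⟩ := exists_measurable_section_of_compact
      (p := fun σ : K n => (g σ).1) (hp.comp continuous_subtype_val)
    refine ⟨fun y => (g (s y)).2,
      (continuous_snd.comp (hg.comp continuous_subtype_val)).measurable.comp hs, ?_⟩
    rintro y ⟨σ, hσ, rfl⟩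
    have h1 : (g (s (g σ).1)).1 = (g σ).1 := hsp _ ⟨⟨σ, hσ⟩, rfl⟩
    have h2 : g (s (g σ).1) ∈ B := hgB ▸ Set.mem_range_self _
    rw [← Prod.mk.eta (p := g (s (g σ).1)), h1] at h2
    exact h2
  choose s hs hsB using hsec
  refine ⟨hUmeas.nullMeasurableSet.congr hae, ?_⟩
  classical
  -- The second alternative only makes `Nat.find` total; it concerns a null part of the projection.
  let P : ℕ → Y → Prop := fun n y =>
    y ∈ (Prod.fst ∘ g) '' K n ∨ y ∉ ⋃ n, (Prod.fst ∘ g) '' K n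
  have hP : ∀ y, ∃ n, P n y := by
    intro y
    by_cases hy : y ∈ ⋃ n, (Prod.fst ∘ g) '' K n
    · obtain ⟨n, hn⟩ := Set.mem_iUnion.mp hy
      exact ⟨n, Or.inl hn⟩
    · exact ⟨0, Or.inr hy⟩
  refine ⟨fun y => s (Nat.find (hP y)) y,
    Measurable.find hs
      (fun n => show MeasurableSet {y | P n y} from (hKmeas n).union hUmeas.compl) hP, ?_⟩
  filter_upwards [hae.mem_iff] with y hy hyB
  rcases Nat.find_spec (hP y) with h | h
  · exact hsB _ _ h
  · exact absurd (hy.mpr hyB) h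

/-! ### Parametrizing probability measures. -/

/-- The set where two finite kernels into a standard Borel space agree is measurable. -/
lemma measurableSet_kernel_eq {A Z : Type*} [MeasurableSpace A] [MeasurableSpace Z]
    [StandardBorelSpace Z] (κ η : Kernel A Z) [IsFiniteKernel κ] [IsFiniteKernel η] :
    MeasurableSet {a | κ a = η a} := by
  have hφ := measurableEmbedding_embeddingReal Z
  -- Embedded in the line, finite measures are determined by their total mass and the rational
  -- half-lines: countably many conditions.
  have : {a | κ a = η a} = {a | κ a Set.univ = η a Set.univ} ∩
      ⋂ q : ℚ, {a | κ a (embeddingReal Z ⁻¹' Set.Iic (q : ℝ))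
        = η a (embeddingReal Z ⁻¹' Set.Iic (q : ℝ))} := by
    ext a
    simp only [Set.mem_ofPred_eq, Set.mem_inter_iff, Set.mem_iInter]
    refine ⟨fun h => by simp [h], fun ⟨h1, h2⟩ => ?_⟩
    have hmap : (κ a).map (embeddingReal Z) = (η a).map (embeddingReal Z) := by
      refine ext_of_generate_finite _ (BorelSpace.measurable_eq.trans
        Real.borel_eq_generateFrom_Iic_rat) Real.isPiSystem_Iic_rat ?_ ?_
      · simp only [Set.mem_iUnion, Set.mem_singleton_iff]
        rintro _ ⟨q, rfl⟩
        rw [hφ.map_apply, hφ.map_apply, h2 q]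
      · rw [hφ.map_apply, hφ.map_apply, Set.preimage_univ, h1]
    rw [← hφ.comap_map (κ a), hmap, hφ.comap_map]
  rw [this]
  exact (measurableSet_eq_fun (κ.measurable_coe .univ) (η.measurable_coe .univ)).inter
    (.iInter fun q => measurableSet_eq_fun (κ.measurable_coe (hφ.measurable measurableSet_Iic))
      (η.measurable_coe (hφ.measurable measurableSet_Iic)))

/-- All the probability measures on a standard Borel space are values of one finite kernel from the
Polish space `ℚ → ℝ`. -/
lemma exists_universal_kernel (Z : Type*) [MeasurableSpace Z] [StandardBorelSpace Z] :
    ∃ M : Kernel (ℚ → ℝ) Z, IsFiniteKernel M ∧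
      ∀ P : Measure Z, IsProbabilityMeasure P → ∃ f, M f = P := by
  have hφ := measurableEmbedding_embeddingReal Z
  let N : Kernel (ℚ → ℝ) ℝ :=
    ⟨fun f => (stieltjesOfMeasurableRat id measurable_id f).measure,
      measurable_measure_stieltjesOfMeasurableRat _⟩
  have : IsMarkovKernel N :=
    ⟨fun f => instIsProbabilityMeasure_stieltjesOfMeasurableRat measurable_id f⟩
  -- The parameter of a measure is its distribution function on `ℚ`. The pullback is only a finite
  -- kernel, since `N f` may charge points outside the image of `Z`.
  refine ⟨N.comapRight hφ, inferInstance, fun P hP => ?_⟩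
  have := Measure.isProbabilityMeasure_map (μ := P) hφ.measurable.aemeasurable
  set Q := P.map (embeddingReal Z) with hQ
  let f : ℚ → ℝ := fun q => cdf Q q
  have hf : IsRatStieltjesPoint id f := by
    refine ⟨fun a b hab => monotone_cdf Q (by exact_mod_cast hab), ?_, ?_, fun t => ?_⟩
    · exact (tendsto_cdf_atTop Q).comp (tendsto_ratCast_atTop_iff.mpr Filter.tendsto_id)
    · exact (tendsto_cdf_atBot Q).comp (tendsto_ratCast_atBot_iff.mpr Filter.tendsto_id)
    · change ⨅ r : Set.Ioi t, cdf Q (r : ℚ) = cdf Q t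
      rw [← (cdf Q).iInf_rat_gt_eq t]
      exact Equiv.iInf_congr (Equiv.subtypeEquivRight fun r => by simp) fun r => rfl
  have hN : N f = Q := by
    refine ext_of_generate_finite _ (BorelSpace.measurable_eq.trans
        Real.borel_eq_generateFrom_Iic_rat) Real.isPiSystem_Iic_rat ?_ (by simp)
    simp only [Set.mem_iUnion, Set.mem_singleton_iff]
    rintro _ ⟨q, rfl⟩
    change (stieltjesOfMeasurableRat id measurable_id f).measure _ = _
    rw [measure_stieltjesOfMeasurableRat_Iic, stieltjesOfMeasurableRat_eq,
      toRatCDF_of_isRatStieltjesPoint hf]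
    exact ofReal_cdf Q q
  refine ⟨f, ?_⟩
  rw [Kernel.comapRight_apply, hN, hQ, hφ.comap_map]

/-! ### Measurable choice of couplings. -/

section TransportKernel

variable {Y X : Type*} [MeasurableSpace Y] [MeasurableSpace X] [StandardBorelSpace X]

lemma isCoupling_prod {E : Type*} [MeasurableSpace E] (ν μ : Measure E) [IsProbabilityMeasure ν]
    [IsProbabilityMeasure μ] : IsCoupling (ν.prod μ) ν μ :=
  ⟨inferInstance, by simp, by simp⟩

lemma isCoupling_of_map_eq {E : Type*} [MeasurableSpace E] {π : Measure (E × E)} {ν μ : Measure E}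
    [IsProbabilityMeasure ν] (h1 : π.map Prod.fst = ν) (h2 : π.map Prod.snd = μ) :
    IsCoupling π ν μ := by
  refine ⟨⟨?_⟩, h1, h2⟩
  rw [← Set.preimage_univ (f := Prod.fst), ← Measure.map_apply measurable_fst .univ, h1,
    measure_univ]

lemma transportCost_le {E : Type*} [MeasurableSpace E] (c : E → E → ℝ≥0) {ν μ : Measure E}
    {π : Measure (E × E)} (h : IsCoupling π ν μ) :
    transportCost c ν μ ≤ ∫⁻ z, (c z.1 z.2 : ℝ≥0∞) ∂π := iInf₂_le π h

lemma transportCost_lt_iff {E : Type*} [MeasurableSpace E] {c : E → E → ℝ≥0} {ν μ : Measure E}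
    {t : ℝ≥0∞} : transportCost c ν μ < t ↔
      ∃ π, IsCoupling π ν μ ∧ ∫⁻ z, (c z.1 z.2 : ℝ≥0∞) ∂π < t := by
  simp only [transportCost, iInf_lt_iff, exists_prop]

lemma exists_coupling_le {E : Type*} [MeasurableSpace E] (c : E → E → ℝ≥0) (ν μ : Measure E)
    [IsProbabilityMeasure ν] [IsProbabilityMeasure μ] {ε : ℝ≥0∞} (hε : ε ≠ 0) :
    ∃ π, IsCoupling π ν μ ∧ ∫⁻ z, (c z.1 z.2 : ℝ≥0∞) ∂π ≤ transportCost c ν μ + ε := by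
  by_cases h : transportCost c ν μ = ∞
  · exact ⟨_, isCoupling_prod ν μ, by simp [h]⟩
  · obtain ⟨π, hπ, hlt⟩ := transportCost_lt_iff.mp (ENNReal.lt_add_right h hε)
    exact ⟨π, hπ, hlt.le⟩

/-- The couplings of `K y` and `μ`, within a finite kernel `M`, form a measurable set. -/
lemma measurableSet_isCoupling {F : Type*} [MeasurableSpace F] (M : Kernel F (X × X))
    [IsFiniteKernel M] (K : Kernel Y X) [IsMarkovKernel K] (μ : Measure X)
    [IsProbabilityMeasure μ] :
    MeasurableSet {z : Y × F | IsCoupling (M z.2) (K z.1) μ} := by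
  let κ₁ : Kernel (Y × F) X := (M.map Prod.fst).comap Prod.snd measurable_snd
  let κ₂ : Kernel (Y × F) X := (M.map Prod.snd).comap Prod.snd measurable_snd
  let K₁ : Kernel (Y × F) X := K.comap Prod.fst measurable_fst
  have : {z : Y × F | IsCoupling (M z.2) (K z.1) μ} =
      {z | κ₁ z = K₁ z} ∩ {z | κ₂ z = Kernel.const (Y × F) μ z} := by
    ext z
    simp only [Set.mem_ofPred_eq, Set.mem_inter_iff, κ₁, κ₂, K₁, Kernel.comap_apply,
      Kernel.const_apply, Kernel.map_apply _ measurable_fst, Kernel.map_apply _ measurable_snd]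
    exact ⟨fun h => h.2, fun h => isCoupling_of_map_eq h.1 h.2⟩
  rw [this]
  exact (measurableSet_kernel_eq _ _).inter (measurableSet_kernel_eq _ _)

variable [StandardBorelSpace Y] {c : X → X → ℝ≥0}

theorem aemeasurable_transportCost (hc : Measurable fun z : X × X => c z.1 z.2)
    (K : Kernel Y X) [IsMarkovKernel K] (μ : Measure X)
    [IsProbabilityMeasure μ] (m : Measure Y) [IsFiniteMeasure m] :
    AEMeasurable (fun y => transportCost c (K y) μ) m := by
  obtain ⟨M, hM, hMs⟩ := exists_universal_kernel (X × X)
  have hc' : Measurable fun z : X × X => (c z.1 z.2 : ℝ≥0∞) := hc.coe_nnreal_ennreal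
  refine NullMeasurable.aemeasurable (measurable_of_Iio
    (δ := NullMeasurableSpace Y m) fun t => ?_)
  have hB : MeasurableSet ({z : Y × (ℚ → ℝ) | IsCoupling (M z.2) (K z.1) μ} ∩
      {z | ∫⁻ w, (c w.1 w.2 : ℝ≥0∞) ∂(M z.2) < t}) :=
    (measurableSet_isCoupling M K μ).inter
      ((hc'.lintegral_kernel.comp measurable_snd) measurableSet_Iio)
  have : (fun y => transportCost c (K y) μ) ⁻¹' Set.Iio t = Prod.fst ''
      ({z : Y × (ℚ → ℝ) | IsCoupling (M z.2) (K z.1) μ} ∩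
      {z | ∫⁻ w, (c w.1 w.2 : ℝ≥0∞) ∂(M z.2) < t}) := by
    ext y
    simp only [Set.mem_preimage, Set.mem_Iio, transportCost_lt_iff, Set.mem_image, Prod.exists,
      exists_and_right, exists_eq_right, Set.mem_inter_iff, Set.mem_ofPred_eq]
    constructor
    · rintro ⟨π, hπ, h⟩
      obtain ⟨f, rfl⟩ := hMs π hπ.1
      exact ⟨f, hπ, h⟩
    · rintro ⟨f, hf⟩
      exact ⟨_, hf⟩
  have h := (exists_measurable_ae_selection m hB).1
  rw [← this] at h
  exact h

/-- Nearly optimal couplings of the values of a kernel with a fixed measure can be chosen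
measurably. -/
theorem exists_kernel_isCoupling (hc : Measurable fun z : X × X => c z.1 z.2)
    (K : Kernel Y X) [IsMarkovKernel K] (μ : Measure X)
    [IsProbabilityMeasure μ] (m : Measure Y) [IsFiniteMeasure m] {ε : ℝ≥0∞} (hε : ε ≠ 0) :
    ∃ κ : Kernel Y (X × X), IsMarkovKernel κ ∧ (∀ y, IsCoupling (κ y) (K y) μ) ∧
      ∀ᵐ y ∂m, ∫⁻ z, (c z.1 z.2 : ℝ≥0∞) ∂(κ y) ≤ transportCost c (K y) μ + ε := by
  classical
  obtain ⟨M, hM, hMs⟩ := exists_universal_kernel (X × X)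
  have hc' : Measurable fun z : X × X => (c z.1 z.2 : ℝ≥0∞) := hc.coe_nnreal_ennreal
  -- The Borel version `g` of the cost makes the set of nearly optimal couplings Borel.
  obtain ⟨g, hg, hTg⟩ := aemeasurable_transportCost hc K μ m
  have hC := measurableSet_isCoupling M K μ
  have hB : MeasurableSet ({z : Y × (ℚ → ℝ) | IsCoupling (M z.2) (K z.1) μ} ∩
      {z | ∫⁻ w, (c w.1 w.2 : ℝ≥0∞) ∂(M z.2) ≤ g z.1 + ε}) :=
    hC.inter (measurableSet_le (hc'.lintegral_kernel.comp measurable_snd)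
      ((hg.comp measurable_fst).add_const ε))
  obtain ⟨s, hs, hsB⟩ := (exists_measurable_ae_selection m hB).2
  have hD : MeasurableSet {y | IsCoupling (M (s y)) (K y) μ} :=
    (measurable_id.prodMk hs) hC
  -- Where the selection fails, the product coupling replaces it, so that every `κ y` is a coupling.
  let κ : Kernel Y (X × X) := Kernel.piecewise hD (M.comap s hs) (K ×ₖ Kernel.const Y μ)
  have hκ : ∀ y, IsCoupling (κ y) (K y) μ := by
    intro y
    simp only [κ, Kernel.piecewise_apply, Kernel.comap_apply]
    split_ifs with h
    · exact h
    · rw [Kernel.prod_apply, Kernel.const_apply]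
      exact isCoupling_prod _ _
  refine ⟨κ, ⟨fun y => (hκ y).1⟩, hκ, ?_⟩
  filter_upwards [hsB, hTg] with y hy hgy
  obtain ⟨π, hπ, hle⟩ := exists_coupling_le c (K y) μ hε
  obtain ⟨f, rfl⟩ := hMs π hπ.1
  have hmem := hy ⟨(y, f), ⟨hπ, by rw [hgy] at hle; exact hle⟩, rfl⟩
  have : κ y = M (s y) := by
    simp only [κ, Kernel.piecewise_apply, Kernel.comap_apply]
    exact if_pos hmem.1
  rw [this, hgy]
  exact hmem.2

end TransportKernel

/-! ### Averaged conditional costs and gluing. -/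

lemma transportCost_map_le {E F : Type*} [MeasurableSpace E] [MeasurableSpace F] {g : E → F}
    (hg : Measurable g) (c : F → F → ℝ≥0) (ν μ : Measure E) :
    transportCost c (ν.map g) (μ.map g) ≤ transportCost (fun x y => c (g x) (g y)) ν μ := by
  refine le_iInf₂ fun π hπ => ?_
  have := hπ.1
  have hgg : Measurable (Prod.map g g) := hg.prodMap hg
  refine (transportCost_le (π := π.map (Prod.map g g)) c
    ⟨Measure.isProbabilityMeasure_map hgg.aemeasurable, ?_, ?_⟩).trans (lintegral_map_le _ _)
  · rw [Measure.map_map measurable_fst hgg, ← hπ.2.1, Measure.map_map hg measurable_fst]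
    rfl
  · rw [Measure.map_map measurable_snd hgg, ← hπ.2.2, Measure.map_map hg measurable_snd]
    rfl

lemma map_prodMap_compProd_comap {A B C : Type*} [MeasurableSpace A] [MeasurableSpace B]
    [MeasurableSpace C] (m : Measure A) [SFinite m] {f : A → B} (hf : Measurable f)
    (K : Kernel B C) [IsSFiniteKernel K] :
    (m ⊗ₘ K.comap f hf).map (Prod.map f id) = m.map f ⊗ₘ K := by
  have hfm : Measurable (Prod.map f (id : C → C)) := hf.prodMap measurable_id
  ext s hs
  rw [Measure.map_apply hfm hs, Measure.compProd_apply (hfm hs), Measure.compProd_apply hs,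
    lintegral_map (Kernel.measurable_kernel_prodMk_left hs) hf]
  rfl

section CondTransportCost

variable {S S' X : Type*} [MeasurableSpace S] [MeasurableSpace S'] [MeasurableSpace X]
  [StandardBorelSpace X] [Nonempty X]

/-- The average, over the first component of a random pair with law `θ`, of the transport cost
between the conditional law of the second component and `μ`. -/
noncomputable def condTransportCost (c : X → X → ℝ≥0) (θ : Measure (S × X)) [IsFiniteMeasure θ]
    (μ : Measure X) : ℝ≥0∞ :=
  ∫⁻ s, transportCost c (θ.condKernel s) μ ∂θ.fst

/-- Disintegrating `ρ` over `S` yields, almost surely, a coupling of the conditional law with `μ`.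
-/
lemma condTransportCost_le (c : X → X → ℝ≥0) (hc : Measurable fun z : X × X => c z.1 z.2)
    (θ : Measure (S × X)) [IsProbabilityMeasure θ] (μ : Measure X) [IsProbabilityMeasure μ]
    (ρ : Measure (S × (X × X))) [IsFiniteMeasure ρ]
    (h1 : ρ.map (Prod.map id Prod.fst) = θ) (h2 : ρ.map (Prod.map id Prod.snd) = θ.fst.prod μ) :
    condTransportCost c θ μ ≤ ∫⁻ z, (c z.2.1 z.2.2 : ℝ≥0∞) ∂ρ := by
  have hfst : ρ.fst = θ.fst := by
    rw [← h1, Measure.fst, Measure.fst, Measure.map_map measurable_fst (by fun_prop)]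
    rfl
  have hρ : θ.fst ⊗ₘ ρ.condKernel = ρ := by rw [← hfst]; exact ρ.disintegrate _
  have e1 : ρ.condKernel.map Prod.fst =ᵐ[θ.fst] θ.condKernel := by
    refine Kernel.ae_eq_of_compProd_eq ?_
    rw [Measure.compProd_map measurable_fst, hρ, h1, θ.disintegrate]
  have e2 : ρ.condKernel.map Prod.snd =ᵐ[θ.fst] Kernel.const S μ := by
    refine Kernel.ae_eq_of_compProd_eq ?_
    rw [Measure.compProd_map measurable_snd, hρ, h2, Measure.compProd_const]
  have hcm : Measurable fun z : S × (X × X) => (c z.2.1 z.2.2 : ℝ≥0∞) :=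
    (hc.comp measurable_snd).coe_nnreal_ennreal
  rw [← hρ, Measure.lintegral_compProd hcm]
  refine lintegral_mono_ae ?_
  filter_upwards [e1, e2] with s hs1 hs2
  rw [Kernel.map_apply _ measurable_fst] at hs1
  rw [Kernel.map_apply _ measurable_snd, Kernel.const_apply] at hs2
  exact transportCost_le c (isCoupling_of_map_eq hs1 hs2)

variable [StandardBorelSpace S]

lemma exists_kernel_condTransportCost_le {c : X → X → ℝ≥0}
    (hc : Measurable fun z : X × X => c z.1 z.2)
    (θ : Measure (S × X)) [IsProbabilityMeasure θ] (μ : Measure X) [IsProbabilityMeasure μ]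
    {ε : ℝ≥0∞} (hε : ε ≠ 0) :
    ∃ κ : Kernel S (X × X), IsMarkovKernel κ ∧ κ.map Prod.fst = θ.condKernel ∧
      κ.map Prod.snd = Kernel.const S μ ∧
      ∫⁻ s, ∫⁻ z, (c z.1 z.2 : ℝ≥0∞) ∂(κ s) ∂θ.fst ≤ condTransportCost c θ μ + ε := by
  obtain ⟨κ, hκ, hκc, hle⟩ := exists_kernel_isCoupling hc θ.condKernel μ θ.fst hε
  refine ⟨κ, hκ, ?_, ?_, ?_⟩
  · ext1 s
    rw [Kernel.map_apply _ measurable_fst, (hκc s).2.1]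
  · ext1 s
    rw [Kernel.map_apply _ measurable_snd, (hκc s).2.2, Kernel.const_apply]
  · refine (lintegral_mono_ae hle).trans_eq ?_
    rw [lintegral_add_right _ measurable_const]
    simp [condTransportCost]

/-- Conditioning on less information decreases the averaged transport cost. -/
lemma condTransportCost_map_le {c : X → X → ℝ≥0} (hc : Measurable fun z : X × X => c z.1 z.2)
    (θ : Measure (S × X)) [IsProbabilityMeasure θ] (μ : Measure X) [IsProbabilityMeasure μ]
    {φ : S → S'} (hφ : Measurable φ) :
    condTransportCost c (θ.map (Prod.map φ id)) μ ≤ condTransportCost c θ μ := by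
  have hφX : Measurable (Prod.map φ (id : X → X)) := hφ.prodMap measurable_id
  have hφXX : Measurable (Prod.map φ (id : X × X → X × X)) := hφ.prodMap measurable_id
  have hθφ : IsProbabilityMeasure (θ.map (Prod.map φ id)) :=
    Measure.isProbabilityMeasure_map hφX.aemeasurable
  refine ENNReal.le_of_forall_pos_le_add fun ε hε _ => ?_
  obtain ⟨κ, hκ, h1, h2, hle⟩ := exists_kernel_condTransportCost_le hc θ μ
    (ENNReal.coe_ne_zero.mpr hε.ne')
  have hcm : Measurable fun z : S × (X × X) => (c z.2.1 z.2.2 : ℝ≥0∞) :=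
    (hc.comp measurable_snd).coe_nnreal_ennreal
  have m1 : Measurable (Prod.map (id : S → S) (Prod.fst : X × X → X)) := by fun_prop
  have m2 : Measurable (Prod.map (id : S → S) (Prod.snd : X × X → X)) := by fun_prop
  -- Pushing the plan along `φ` mixes the couplings over the fibres of `φ` and leaves the pair in `X
  -- × X`, hence the cost, untouched.
  refine (condTransportCost_le c hc _ μ ((θ.fst ⊗ₘ κ).map (Prod.map φ id)) ?_ ?_).trans ?_
  · have : θ = (θ.fst ⊗ₘ κ).map (Prod.map id Prod.fst) := by
      rw [← Measure.compProd_map measurable_fst, h1, θ.disintegrate]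
    conv_rhs => rw [this]
    rw [Measure.map_map (by fun_prop) hφXX, Measure.map_map hφX m1]
    rfl
  · have : (θ.fst ⊗ₘ κ).map (Prod.map id Prod.snd) = θ.fst.prod μ := by
      rw [← Measure.compProd_map measurable_snd, h2, Measure.compProd_const]
    have hf : (θ.map (Prod.map φ id)).fst = θ.fst.map φ := by
      rw [Measure.fst, Measure.fst, Measure.map_map measurable_fst hφX,
        Measure.map_map hφ measurable_fst]
      rfl
    have h3 : (θ.fst.map φ).prod μ = (θ.fst.prod μ).map (Prod.map φ id) := by
      rw [← Measure.map_prod_map _ _ hφ measurable_id, Measure.map_id]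
    rw [hf, h3, ← this, Measure.map_map (by fun_prop) hφXX, Measure.map_map hφX m2]
    rfl
  · refine (lintegral_map_le _ _).trans ?_
    refine le_trans (le_of_eq ?_) hle
    exact Measure.lintegral_compProd hcm

/-- Gluing a coupling of the first components with couplings of the conditional laws of the second
components. -/
lemma transportCost_prod_le {c : X → X → ℝ≥0} (hc : Measurable fun z : X × X => c z.1 z.2)
    {d : S → S → ℝ≥0} (hd : Measurable fun z : S × S => d z.1 z.2)
    (θ : Measure (S × X)) [IsProbabilityMeasure θ] (μ : Measure X) [IsProbabilityMeasure μ]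
    (μ' : Measure S) [IsProbabilityMeasure μ'] :
    transportCost (fun x y : S × X => d x.1 y.1 + c x.2 y.2) θ (μ'.prod μ) ≤
      transportCost d θ.fst μ' + condTransportCost c θ μ := by
  refine ENNReal.le_of_forall_pos_le_add fun ε hε _ => ?_
  have hε2 : (ε : ℝ≥0∞) / 2 ≠ 0 := (ENNReal.half_pos (ENNReal.coe_ne_zero.mpr hε.ne')).ne'
  obtain ⟨κ, hκ, h1, h2, hle⟩ := exists_kernel_condTransportCost_le hc θ μ hε2
  obtain ⟨π, hπ, hπle⟩ := exists_coupling_le d θ.fst μ' hε2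
  have := hπ.1
  -- The coupling of the second components depends only on the first of the two tails.
  let κ' : Kernel (S × S) (X × X) := κ.comap Prod.fst measurable_fst
  have hκ' : IsMarkovKernel κ' := inferInstanceAs (IsMarkovKernel (κ.comap _ _))
  let F : (S × S) × (X × X) → (S × X) × (S × X) :=
    fun w => ((w.1.1, w.2.1), (w.1.2, w.2.2))
  have hF : Measurable F := by fun_prop
  have hmarg1 : ((π ⊗ₘ κ').map F).map Prod.fst = θ := by
    have e : κ'.map Prod.fst = θ.condKernel.comap Prod.fst measurable_fst := by
      rw [← h1]
      ext1 s
      simp only [κ', Kernel.map_apply _ measurable_fst, Kernel.comap_apply]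
    have : (π ⊗ₘ κ').map (Prod.map id Prod.fst)
        = π ⊗ₘ θ.condKernel.comap Prod.fst measurable_fst := by
      rw [← Measure.compProd_map measurable_fst, e]
    rw [← θ.disintegrate θ.condKernel, ← hπ.2.1, ← map_prodMap_compProd_comap _ measurable_fst, ← this,
      Measure.map_map measurable_fst hF, Measure.map_map (by fun_prop) (by fun_prop)]
    rfl
  have hmarg2 : ((π ⊗ₘ κ').map F).map Prod.snd = μ'.prod μ := by
    have e : κ'.map Prod.snd = Kernel.const (S × S) μ := by
      ext1 s
      have := congrArg (fun k : Kernel S X => k s.1) h2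
      simpa only [κ', Kernel.map_apply _ measurable_snd, Kernel.comap_apply,
        Kernel.const_apply] using this
    have : (π ⊗ₘ κ').map (Prod.map id Prod.snd) = π.prod μ := by
      rw [← Measure.compProd_map measurable_snd, e, Measure.compProd_const]
    have h3 : μ'.prod μ = (π.prod μ).map (Prod.map Prod.snd id) := by
      rw [← Measure.map_prod_map _ _ measurable_snd measurable_id, Measure.map_id, hπ.2.2]
    rw [h3, ← this, Measure.map_map measurable_snd hF,
      Measure.map_map (by fun_prop) (by fun_prop)]
    rfl
  refine (transportCost_le _ (isCoupling_of_map_eq hmarg1 hmarg2)).trans ?_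
  refine (lintegral_map_le _ _).trans ?_
  have hdm : Measurable fun w : (S × S) × (X × X) => (d w.1.1 w.1.2 : ℝ≥0∞) :=
    (hd.comp measurable_fst).coe_nnreal_ennreal
  have hcm : Measurable fun w : (S × S) × (X × X) => (c w.2.1 w.2.2 : ℝ≥0∞) :=
    (hc.comp measurable_snd).coe_nnreal_ennreal
  have hκm : Measurable fun s => ∫⁻ z, (c z.1 z.2 : ℝ≥0∞) ∂(κ s) :=
    hc.coe_nnreal_ennreal.lintegral_kernel
  calc ∫⁻ w, ((d w.1.1 w.1.2 + c w.2.1 w.2.2 : ℝ≥0) : ℝ≥0∞) ∂(π ⊗ₘ κ')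
      = ∫⁻ w, (d w.1.1 w.1.2 : ℝ≥0∞) ∂(π ⊗ₘ κ') + ∫⁻ w, (c w.2.1 w.2.2 : ℝ≥0∞) ∂(π ⊗ₘ κ') := by
        simp only [ENNReal.coe_add]
        exact lintegral_add_left hdm _
    _ = ∫⁻ z, (d z.1 z.2 : ℝ≥0∞) ∂π + ∫⁻ s, ∫⁻ z, (c z.1 z.2 : ℝ≥0∞) ∂(κ s) ∂θ.fst := by
        rw [Measure.lintegral_compProd hdm, Measure.lintegral_compProd hcm, ← hπ.2.1,
          lintegral_map hκm measurable_fst]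
        simp [κ']
    _ ≤ (transportCost d θ.fst μ' + ε / 2) + (condTransportCost c θ μ + ε / 2) := by gcongr
    _ = _ := by rw [add_add_add_comm, ENNReal.add_halves]

end CondTransportCost

-- Induction on the number of coordinates.

universe u

@[fun_prop]
lemma measurable_eraseCoord {n : ℕ} {X : Fin n → Type*} [∀ i, MeasurableSpace (X i)] (i : Fin n) :
    Measurable (eraseCoord (X := X) i) :=
  measurable_pi_lambda _ fun j => measurable_pi_apply (j : Fin n)

/-- Tensorization of the transport cost, with the conditional laws of the coordinates expressed
through joint laws. -/
theorem transportCost_sumCost_le (n : ℕ) : ∀ {X : Fin n → Type u} [∀ i, MeasurableSpace (X i)]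
    [∀ i, StandardBorelSpace (X i)] [∀ i, Nonempty (X i)] (c : ∀ i, X i → X i → ℝ≥0)
    (_ : ∀ i, Measurable fun z : X i × X i => c i z.1 z.2)
    (μ : ∀ i, Measure (X i)) [∀ i, IsProbabilityMeasure (μ i)]
    (ν : Measure (∀ i, X i)) [IsProbabilityMeasure ν],
    transportCost (sumCost c) ν (Measure.pi μ) ≤
      ∑ i, condTransportCost (c i) (ν.map fun x => (eraseCoord i x, x i)) (μ i) := by
  induction n with
  | zero =>
    intro X _ _ _ c hc μ _ ν _
    refine (transportCost_le _ (isCoupling_prod ν (Measure.pi μ))).trans ?_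
    simp [sumCost]
  | succ n ih =>
    intro X _ _ _ c hc μ _ ν _
    let X' : Fin n → Type u := fun i => X ((0 : Fin (n + 1)).succAbove i)
    let c' : ∀ i, X' i → X' i → ℝ≥0 := fun i => c ((0 : Fin (n + 1)).succAbove i)
    let μ' : ∀ i, Measure (X' i) := fun i => μ ((0 : Fin (n + 1)).succAbove i)
    have hμ' : ∀ i, IsProbabilityMeasure (μ' i) := fun i =>
      inferInstanceAs (IsProbabilityMeasure (μ _))
    have hX' : ∀ i, StandardBorelSpace (X' i) := fun i =>
      inferInstanceAs (StandardBorelSpace (X _))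
    have hX'n : ∀ i, Nonempty (X' i) := fun i => inferInstanceAs (Nonempty (X _))
    have hc' : ∀ i, Measurable fun z : X' i × X' i => c' i z.1 z.2 := fun i => hc _
    let tail : (∀ i, X i) → ∀ i, X' i := fun x i => x ((0 : Fin (n + 1)).succAbove i)
    have htail : Measurable tail := measurable_pi_lambda _ fun i => measurable_pi_apply _
    let e := MeasurableEquiv.piFinSuccAbove X 0
    let g : (∀ i, X' i) × X 0 → ∀ i, X i := fun p => e.symm (p.2, p.1)
    have hg : Measurable g := e.symm.measurable.comp measurable_swap
    let h : (∀ i, X i) → (∀ i, X' i) × X 0 := fun x => (tail x, x 0)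
    have hh : Measurable h := htail.prodMk (measurable_pi_apply 0)
    have hgh : ∀ x, g (h x) = x := fun x => e.symm_apply_apply x
    have hhg : ∀ p, h (g p) = p := fun p =>
      congrArg Prod.swap (e.apply_symm_apply (p.2, p.1))
    have hν : (ν.map h).map g = ν := by
      rw [Measure.map_map hg hh]
      simp [Function.comp_def, hgh]
    have hμ : ((Measure.pi μ').prod (μ 0)).map g = Measure.pi μ := by
      have h1 := (measurePreserving_piFinSuccAbove μ 0).symm.map_eq
      rw [← h1, ← Measure.prod_swap, Measure.map_map hg measurable_swap]
      rfl
    have hprob : IsProbabilityMeasure (ν.map h) :=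
      Measure.isProbabilityMeasure_map hh.aemeasurable
    have hprob' : IsProbabilityMeasure (ν.map tail) :=
      Measure.isProbabilityMeasure_map htail.aemeasurable
    have hfst : (ν.map h).fst = ν.map tail := Measure.fst_map_prodMk (measurable_pi_apply 0)
    have hcost : (fun p q => sumCost c (g p) (g q)) =
        fun p q : (∀ i, X' i) × X 0 => sumCost c' p.1 q.1 + c 0 p.2 q.2 := by
      funext p q
      have key : ∀ x y : ∀ i, X i,
          sumCost c x y = sumCost c' (h x).1 (h y).1 + c 0 (h x).2 (h y).2 := fun x y => by
        rw [sumCost, Fin.sum_univ_succAbove _ 0, add_comm]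
        rfl
      rw [key, hhg, hhg]
    have hsum : Measurable fun z : (∀ i, X' i) × (∀ i, X' i) => sumCost c' z.1 z.2 := by
      unfold sumCost
      exact Finset.measurable_fun_sum _ fun i _ => (hc' i).comp
        (((measurable_pi_apply i).comp measurable_fst).prodMk
          ((measurable_pi_apply i).comp measurable_snd))
    have hlaw : ∀ i : Fin (n + 1), IsProbabilityMeasure (ν.map fun x => (eraseCoord i x, x i)) :=
      fun i => Measure.isProbabilityMeasure_map (by fun_prop)
    calc transportCost (sumCost c) ν (Measure.pi μ)
        ≤ transportCost (fun p q => sumCost c (g p) (g q)) (ν.map h)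
            ((Measure.pi μ').prod (μ 0)) := by
          conv_lhs => rw [← hν, ← hμ]
          exact transportCost_map_le hg _ _ _
      _ ≤ transportCost (sumCost c') (ν.map tail) (Measure.pi μ')
            + condTransportCost (c 0) (ν.map h) (μ 0) := by
          rw [hcost, ← hfst]
          exact transportCost_prod_le (hc 0) hsum _ _ _
      _ ≤ ∑ i, condTransportCost (c' i) ((ν.map tail).map fun x => (eraseCoord i x, x i)) (μ' i)
            + condTransportCost (c 0) (ν.map h) (μ 0) := by
          gcongr
          exact ih c' hc' μ' _
      _ ≤ ∑ i : Fin n, condTransportCost (c ((0 : Fin (n + 1)).succAbove i))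
              (ν.map fun x => (eraseCoord ((0 : Fin (n + 1)).succAbove i) x,
                x ((0 : Fin (n + 1)).succAbove i))) (μ ((0 : Fin (n + 1)).succAbove i))
            + condTransportCost (c 0) (ν.map fun x => (eraseCoord 0 x, x 0)) (μ 0) := by
          refine add_le_add (Finset.sum_le_sum fun i _ => ?_) ?_
          -- Here `φ` forgets the coordinate `0`: a genuine loss of information.
          · let φ : (∀ j : {j // j ≠ (0 : Fin (n + 1)).succAbove i}, X j) →
                ∀ j : {j // j ≠ i}, X' j := fun y j =>
              y ⟨(0 : Fin (n + 1)).succAbove j, fun h => j.2 (Fin.succAbove_right_injective h)⟩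
            have hφ : Measurable φ := measurable_pi_lambda _ fun j => measurable_pi_apply _
            have hlaw' : (ν.map tail).map (fun x => (eraseCoord i x, x i)) =
                (ν.map fun x => (eraseCoord ((0 : Fin (n + 1)).succAbove i) x,
                  x ((0 : Fin (n + 1)).succAbove i))).map (Prod.map φ id) := by
              rw [Measure.map_map (by fun_prop) htail,
                Measure.map_map (hφ.prodMap measurable_id) (by fun_prop)]
              rfl
            simp only [hlaw']
            exact condTransportCost_map_le (hc _) _ _ hφ
          -- Here `φ` merely relabels the nonzero indices by `Fin n`.
          · let φ : (∀ j : {j // j ≠ (0 : Fin (n + 1))}, X j) → ∀ j, X' j := fun y j =>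
              y ⟨(0 : Fin (n + 1)).succAbove j, Fin.succAbove_ne 0 j⟩
            have hφ : Measurable φ := measurable_pi_lambda _ fun j => measurable_pi_apply _
            have hlaw' : ν.map h = (ν.map fun x => (eraseCoord 0 x, x 0)).map (Prod.map φ id) := by
              rw [Measure.map_map (hφ.prodMap measurable_id) (by fun_prop)]
              rfl
            simp only [hlaw']
            exact condTransportCost_map_le (hc _) _ _ hφ
      _ = _ := by rw [Fin.sum_univ_succAbove _ 0, add_comm]

theorem mainTheorem6 {n : ℕ} {X : Fin n → Type*}
    [∀ i, TopologicalSpace (X i)] [∀ i, PolishSpace (X i)]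
    [∀ i, MeasurableSpace (X i)] [∀ i, BorelSpace (X i)] [∀ i, Nonempty (X i)]
    (c : ∀ i, X i → X i → ℝ≥0)
    (hc : ∀ i, LowerSemicontinuous (fun z : X i × X i => c i z.1 z.2))
    (μ : ∀ i, Measure (X i)) [∀ i, IsProbabilityMeasure (μ i)]
    (ν : Measure (∀ i, X i)) [IsProbabilityMeasure ν] :
    (∀ i, AEMeasurable
      (fun x : ∀ j, X j => transportCost (c i) (condCoord ν i (eraseCoord i x)) (μ i)) ν) ∧
    transportCost (sumCost c) ν (Measure.pi μ) ≤
      ∫⁻ x, ∑ i, transportCost (c i) (condCoord ν i (eraseCoord i x)) (μ i) ∂ν := by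
  have hcm : ∀ i, Measurable fun z : X i × X i => c i z.1 z.2 := fun i => (hc i).measurable
  have hK : ∀ i, IsMarkovKernel (condCoord ν i) := fun i => by
    unfold condCoord
    infer_instance
  have haem : ∀ i, AEMeasurable (fun y => transportCost (c i) (condCoord ν i y) (μ i))
      (ν.map (eraseCoord i)) := fun i =>
    aemeasurable_transportCost (hcm i) _ _ _
  have haem' : ∀ i, AEMeasurable
      (fun x => transportCost (c i) (condCoord ν i (eraseCoord i x)) (μ i)) ν := fun i =>
    (haem i).comp_measurable (measurable_eraseCoord i)
  refine ⟨haem', ?_⟩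
  rw [lintegral_finsetSum' _ fun i _ => haem' i]
  refine (transportCost_sumCost_le n c hcm μ ν).trans_eq (Finset.sum_congr rfl fun i _ => ?_)
  rw [condTransportCost, Measure.fst_map_prodMk (measurable_pi_apply i)]
  have : condCoord ν i = (ν.map fun x => (eraseCoord i x, x i)).condKernel := by
    rw [condCoord, condDistrib]
  rw [← this, lintegral_map' (haem i) (measurable_eraseCoord i).aemeasurable]
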